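/- Let $K$ be a field of characteristic zero and let $\mathbb{I}_1\subseteq \mathrm{End}_K(K[x])$ be the algebra of polynomial integro-differential operators, i.e. the subalgebra generated by multiplication by $x$, by $\partial=d/dx$ and by the integration $\int: x^n\mapsto \frac{x^{n+1}}{n+1}$. Put $H=\partial x$, $e_{ij}=\int^i\partial^j-\int^{i+1}\partial^{j+1}$ for $i,j\in\mathbb{N}=\{0,1,2,\dots\}$, and $F=\bigoplus_{i,j\in\mathbb{N}}Ke_{ij}$. For a ring $R$ let ${}'\mathcal{C}_R=\{c\in R: rc=0\Rightarrow r=0\}$ and $\mathcal{C}'_R=\{c\in R: cr=0\Rightarrow r=0\}$ be the sets of left and of right regular elements. Let $$\Gamma=\Big\{a_0+\sum_{i\ge 1}\textstyle\int^i a_i+f \;:\; \text{all } a_i\in K[H] \text{ (almost all zero)},\ a_0\neq 0,\ f\in F\Big\}.$$ Let $*$ be the involution of $\mathbb{I}_1$, i.e. the $K$-algebra anti-isomorphism with $a^{**}=a$, $\partial^*=\int$, $\int^*=\partial$, $H^*=H$. For every $a\in\Gamma$ there is $i\in\mathbb{N}$ with $\partial^i a\in{}'\mathcal{C}_{\mathbb{I}_1}$.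 Let $d(a)$ be the least such $i$ (the left regularity degree of $a$). Then: 1. ${}'\mathcal{C}_{\mathbb{I}_1}=\{\partial^{d(a)+i}a : i\in\mathbb{N},\ a\in\Gamma\}$. 2. The degree $d$ is computed as follows. Give $P'=K[\partial]$ the right $\mathbb{I}_1$-module structure obtained by identifying $p\in K[\partial]$ with $e_{00}p\in e_{00}K[\partial]$, so that $\partial^i\cdot\partial=\partial^{i+1}$, $\partial^{i+1}\cdot\int=\partial^{i}$, $1\cdot\int=0$, $\partial^i\cdot H=(i+1)\partial^i$; and let $\mathcal{K}_a=\{p\in P': p\cdot a=0\}$. Let $a=a_0+\sum_{i\ge1}\int^ia_i+f\in\Gamma$. Let $s=-1$ if $f=0$, and let $s=\min\{m\in\mathbb{N}: f\in\bigoplus_{i,j=0}^mKe_{ij}\}$ otherwise. View $a_0$ as a polynomial in $H$ and let $R(a)=\{i\in\mathbb{N}: a_0(i+1)=0,\ i>s\}$, a finite set; if $R(a)\ne\emptyset$, let $r$ be its largest element. Write $P'_{\le s}=\bigoplus_{0\le j\le s}K\partial^j$. Then $a\in{}'\mathcal{C}_{\mathbb{I}_1}$ if and only if $R(a)=\emptyset$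 and $\mathcal{K}_a\cap P'_{\le s}=0$, and in that case $d(a)=0$. Otherwise $$d(a)=\begin{cases}\min\{i : 0\le i\le r+1,\ \mathcal{K}_a\cap\bigoplus_{j=i}^{r+1}K\partial^j=0\} & \text{if } R(a)\neq\emptyset,\\[2pt] \min\{i : 0\le i\le s+1,\ \mathcal{K}_a\cap\bigoplus_{j=i}^{s+1}K\partial^j=0\} & \text{if } R(a)=\emptyset \text{ and } \mathcal{K}_a\cap P'_{\le s}\neq0.\end{cases}$$ 3. $\mathcal{C}'_{\mathbb{I}_1}=({}'\mathcal{C}_{\mathbb{I}_1})^*$. -/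

import Mathlib

open Polynomial

noncomputable section

/-- Left regular elements of a ring: those `c` for which `r ↦ r * c` has zero kernel. -/
def leftRegularElements (R : Type*) [Ring R] : Set R :=
  {c | ∀ r : R, r * c = 0 → r = 0}

/-- Right regular elements of a ring: those `c` for which `r ↦ c * r` has zero kernel. -/
def rightRegularElements (R : Type*) [Ring R] : Set R :=
  {c | ∀ r : R, c * r = 0 → r = 0}

namespace PolyIntDiff

variable (K : Type*) [Field K]

/-- Integration on `K[x]`: `x ^ n ↦ x ^ (n + 1) / (n + 1)`. -/
def integration : K[X] →ₗ[K] K[X] :=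
  (Polynomial.basisMonomials K).constr K fun n => C ((n + 1 : K)⁻¹) * X ^ (n + 1)

/-- The algebra of polynomial integro-differential operators: the subalgebra of `End_K(K[x])`
generated by multiplication by `x`, by `d/dx`, and by integration. -/
def I1Subalgebra : Subalgebra K (Module.End K K[X]) :=
  Algebra.adjoin K {LinearMap.mulLeft K (X : K[X]), Polynomial.derivative, integration K}

/-- The algebra of polynomial integro-differential operators, as a type. -/
def I1 : Type _ := I1Subalgebra K

instance : Ring (I1 K) := inferInstanceAs (Ring (I1Subalgebra K))

instance : Algebra K (I1 K) := inferInstanceAs (Algebra K (I1Subalgebra K))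

variable {K} in
/-- The inclusion into `End_K(K[x])`. -/
def toEnd : I1 K →ₐ[K] Module.End K K[X] := (I1Subalgebra K).val

variable {K} in
theorem toEnd_injective : Function.Injective (toEnd (K := K)) := Subtype.val_injective

/-- The operator of multiplication by `x`. -/
def mulX : I1 K := ⟨LinearMap.mulLeft K (X : K[X]), Algebra.subset_adjoin (by simp)⟩

/-- The operator `∂ = d/dx`. -/
def der : I1 K := ⟨Polynomial.derivative, Algebra.subset_adjoin (by simp)⟩

/-- The operator of integration. -/
def int : I1 K := ⟨integration K, Algebra.subset_adjoin (by simp)⟩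

/-- `H = ∂ x`. -/
def H : I1 K := der K * mulX K

/-- `e_{ij} = ∫^i ∂^j - ∫^(i+1) ∂^(j+1)`. -/
def e (i j : ℕ) : I1 K := int K ^ i * der K ^ j - int K ^ (i + 1) * der K ^ (j + 1)

/-- `F = ⊕_{i,j ∈ ℕ} K e_{ij}`. -/
def F : Submodule K (I1 K) := Submodule.span K (Set.range fun ij : ℕ × ℕ => e K ij.1 ij.2)

/-- `⊕_{i,j = 0}^m K e_{ij}`. -/
def FLe (m : ℕ) : Submodule K (I1 K) :=
  Submodule.span K {y | ∃ i j : ℕ, i ≤ m ∧ j ≤ m ∧ y = e K i j}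

variable {K}

/-- The element `a_0 + ∑_{i ≥ 1} ∫^i a_i + f`, where `a_i = p_i(H)`. -/
def canonicalSum (p : ℕ →₀ K[X]) (f : I1 K) : I1 K :=
  (p.sum fun i q => int K ^ i * aeval (H K) q) + f

variable (K)

/-- The set `Γ` of all `a_0 + ∑_{i ≥ 1} ∫^i a_i + f` with all `a_i ∈ K[H]`, `a_0 ≠ 0`, `f ∈ F`. -/
def Gam : Set (I1 K) :=
  {a | ∃ (p : ℕ →₀ K[X]) (f : I1 K), p 0 ≠ 0 ∧ f ∈ F K ∧ a = canonicalSum p f}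

variable {K}

/-- The left regularity degree `min {i | ∂^i a is left regular}`. -/
def leftRegDegree (a : I1 K) : ℕ := sInf {i : ℕ | der K ^ i * a ∈ leftRegularElements (I1 K)}

open Classical in
/-- The size of `f ∈ F`: it is `-1` if `f = 0`, and the least `m` with
`f ∈ ⊕_{i,j = 0}^m K e_{ij}` otherwise. -/
def size (f : I1 K) : ℤ := if f = 0 then -1 else ((sInf {m : ℕ | f ∈ FLe K m} : ℕ) : ℤ)

/-- The natural numbers `i > s` with `a₀(i + 1) = 0`. -/
def bigRoots (a₀ : K[X]) (s : ℤ) : Set ℕ := {i : ℕ | a₀.eval ((i : K) + 1) = 0 ∧ s < (i : ℤ)}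

variable (K)

/-- `K[∂]`, as a subspace of the algebra. -/
def polyDer : Submodule K (I1 K) := Subalgebra.toSubmodule (Algebra.adjoin K {der K})

/-- `⊕_{i ≤ j ≤ m} K ∂^j` (zero if `m < i`). -/
def derSegment (i : ℕ) (m : ℤ) : Submodule K (I1 K) :=
  Submodule.span K {y | ∃ j : ℕ, i ≤ j ∧ (j : ℤ) ≤ m ∧ y = der K ^ j}

variable {K}

/-- The kernel of right multiplication by `a` on the right module `P' = K[∂]`, whose
module structure is obtained by identifying `p ∈ K[∂]` with `e_{00} p ∈ e_{00} K[∂]`. The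
resulting action (`∂^i · ∂ = ∂^(i+1)`, `∂^(i+1) · ∫ = ∂^i`, `1 · ∫ = 0`, `∂^i · H = (i+1) ∂^i`)
is recorded in the lemmas `e_zero_mul_der`, ... below. -/
def kerRight (a : I1 K) : Submodule K (I1 K) where
  carrier := {p | p ∈ polyDer K ∧ e K 0 0 * p * a = 0}
  zero_mem' := ⟨zero_mem _, by rw [mul_zero, zero_mul]⟩
  add_mem' := fun hp hq => ⟨add_mem hp.1 hq.1, by rw [mul_add, add_mul, hp.2, hq.2, add_zero]⟩
  smul_mem' := fun c p hp => ⟨Submodule.smul_mem _ c hp.1, by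
    rw [mul_smul_comm, smul_mul_assoc, hp.2, smul_zero]⟩

theorem e_zero_mul_der (i : ℕ) : e K 0 0 * der K ^ i * der K = e K 0 0 * der K ^ (i + 1) := by
  rw [pow_succ, mul_assoc]

/-! ### The involution

The involution is the adjoint for the symmetric bilinear form on `K[x]` in which the divided powers
`x^n / n!` form an orthonormal basis. -/

variable (K) in
/-- The bilinear form with `⟨x^m, x^n⟩ = δ_{mn} (n!)²`. -/
def form : K[X] →ₗ[K] K[X] →ₗ[K] K :=
  (Polynomial.basisMonomials K).constr K fun n => ((n.factorial : K) ^ 2) • Polynomial.lcoeff K n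

theorem form_X_pow (n : ℕ) (q : K[X]) :
    form K (X ^ n) q = (n.factorial : K) ^ 2 * q.coeff n := by
  have h := (Polynomial.basisMonomials K).constr_basis K
    (fun n => ((n.factorial : K) ^ 2) • Polynomial.lcoeff K n) n
  simp only [Polynomial.coe_basisMonomials, Polynomial.monomial_one_right_eq_X_pow] at h
  simp [form, h]

theorem form_comm (p q : K[X]) : form K p q = form K q p := by
  have : form K = (form K).flip := by
    ext m n
    simp only [LinearMap.comp_apply, LinearMap.flip_apply, Polynomial.monomial_one_right_eq_X_pow,
      form_X_pow, coeff_X_pow]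
    by_cases h : m = n
    · subst h; simp
    · simp [h, Ne.symm h]
  conv_lhs => rw [this]
  rfl

theorem integration_X_pow (n : ℕ) :
    integration K (X ^ n) = C ((n + 1 : K)⁻¹) * X ^ (n + 1) := by
  have h := (Polynomial.basisMonomials K).constr_basis K
    (fun n => (C ((n + 1 : K)⁻¹) * X ^ (n + 1) : K[X])) n
  simp only [Polynomial.coe_basisMonomials, Polynomial.monomial_one_right_eq_X_pow] at h
  exact h

/-- Two operators are adjoint to each other for `form`. -/
def IsAdj (a b : Module.End K K[X]) : Prop := ∀ p q, form K (a p) q = form K p (b q)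

theorem isAdj_of_pow {a b : Module.End K K[X]}
    (h : ∀ m n : ℕ, form K (a (X ^ m)) (X ^ n) = form K (X ^ m) (b (X ^ n))) : IsAdj a b := by
  have : (form K).comp a = (form K).compl₂ b := by
    ext m n
    simpa [Polynomial.monomial_one_right_eq_X_pow] using h m n
  intro p q
  exact congrArg (fun L => L p q) this

theorem IsAdj.symm {a b : Module.End K K[X]} (h : IsAdj a b) : IsAdj b a := fun p q => by
  rw [form_comm, ← h, form_comm]

theorem IsAdj.mul {a b c d : Module.End K K[X]} (h : IsAdj a b) (h' : IsAdj c d) :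
    IsAdj (a * c) (d * b) := fun p q => by
  simp only [Module.End.mul_apply]; rw [h, h']

theorem IsAdj.add {a b c d : Module.End K K[X]} (h : IsAdj a b) (h' : IsAdj c d) :
    IsAdj (a + c) (b + d) := fun p q => by
  simp [h p q, h' p q]

theorem isAdj_algebraMap (r : K) :
    IsAdj (algebraMap K (Module.End K K[X]) r) (algebraMap K (Module.End K K[X]) r) :=
  fun p q => by simp [Module.algebraMap_end_apply]

theorem isAdj_H : IsAdj (toEnd (H K)) (toEnd (H K)) := by
  have key : ∀ n : ℕ, (toEnd (H K)) (X ^ n) = C (n + 1 : K) * X ^ n := by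
    intro n
    have : (toEnd (H K)) (X ^ n) = derivative (X * X ^ n) := rfl
    rw [this, ← pow_succ', derivative_X_pow]
    simp
  refine isAdj_of_pow fun m n => ?_
  rw [key, key, form_comm, form_X_pow, form_X_pow, coeff_C_mul, coeff_C_mul, coeff_X_pow,
    coeff_X_pow]
  by_cases h : m = n
  · subst h; simp
  · simp [h, Ne.symm h]

theorem mul_pow_mul_eq {A : Type*} [Ring A] [Algebra K A] {d h u : A} (hc : d * h = h * d + d)
    (hu : u * h = u) (i : ℕ) : u * d ^ i * h = ((i : K) + 1) • (u * d ^ i) := by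
  induction i with
  | zero => simp [hu]
  | succ i ih =>
    rw [pow_succ, ← mul_assoc, mul_assoc _ d h, hc, mul_add, ← mul_assoc _ h d, ih]
    push_cast
    rw [smul_mul_assoc, add_smul ((i : K) + 1) (1 : K), one_smul]

variable [CharZero K]

theorem IsAdj.unique {a b b' : Module.End K K[X]} (h : IsAdj a b) (h' : IsAdj a b') : b = b' := by
  refine LinearMap.ext fun q => Polynomial.ext fun n => ?_
  have := (h (X ^ n) q).symm.trans (h' (X ^ n) q)
  rw [form_X_pow, form_X_pow] at this
  exact mul_left_cancel₀ (pow_ne_zero 2 (Nat.cast_ne_zero.2 n.factorial_ne_zero)) this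

theorem isAdj_der_int : IsAdj (Polynomial.derivative : K[X] →ₗ[K] K[X]) (integration K) := by
  refine isAdj_of_pow fun m n => ?_
  have hn : (n + 1 : K) ≠ 0 := by exact_mod_cast Nat.succ_ne_zero n
  rw [form_comm, form_X_pow, form_X_pow, integration_X_pow, Polynomial.derivative_X_pow,
    coeff_C_mul, coeff_C_mul, coeff_X_pow, coeff_X_pow]
  by_cases h : m = n + 1
  · subst h
    simp [Nat.factorial_succ]
    field_simp
  · rcases m with _ | m
    · simp
    · have : n ≠ m := fun h' => h (by rw [h'])
      simp [this, Ne.symm this]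

theorem der_mul_int : der K * int K = 1 := by
  refine toEnd_injective ((Polynomial.basisMonomials K).ext fun n => ?_)
  have hn : (n + 1 : K) ≠ 0 := by exact_mod_cast Nat.succ_ne_zero n
  simp only [Polynomial.coe_basisMonomials, Polynomial.monomial_one_right_eq_X_pow]
  change derivative (integration K (X ^ n)) = X ^ n
  rw [integration_X_pow, derivative_C_mul, derivative_X_pow, ← mul_assoc, ← C_mul]
  simp [hn]

theorem mulX_eq : mulX K = int K * H K := by
  refine toEnd_injective ((Polynomial.basisMonomials K).ext fun n => ?_)
  have hn : (n + 1 : K) ≠ 0 := by exact_mod_cast Nat.succ_ne_zero n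
  simp only [Polynomial.coe_basisMonomials, Polynomial.monomial_one_right_eq_X_pow]
  change X * X ^ n = integration K (derivative (X * X ^ n))
  rw [← pow_succ', derivative_X_pow, Nat.add_sub_cancel, ← smul_eq_C_mul, map_smul,
    integration_X_pow, smul_eq_C_mul, ← mul_assoc, ← C_mul]
  simp [hn]

theorem exists_isAdj (a : I1 K) :
    ∃ b : I1 K, IsAdj (toEnd a) (toEnd b) := by
  obtain ⟨a, ha⟩ := a
  induction ha using Algebra.adjoin_induction with
  | mem y hy =>
    rcases hy with rfl | rfl | rfl
    · refine ⟨H K * der K, ?_⟩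
      have := (isAdj_der_int (K := K)).symm.mul isAdj_H
      have h2 := congrArg toEnd (mulX_eq (K := K))
      change LinearMap.mulLeft K (X : K[X]) = _ at h2
      change IsAdj (LinearMap.mulLeft K (X : K[X])) _
      rw [h2]
      exact this
    · exact ⟨int K, isAdj_der_int⟩
    · exact ⟨der K, isAdj_der_int.symm⟩
  | algebraMap r => exact ⟨algebraMap K (I1 K) r, isAdj_algebraMap r⟩
  | add x y hx hy h h' =>
    obtain ⟨b, hb⟩ := h
    obtain ⟨c, hc⟩ := h'
    exact ⟨b + c, hb.add hc⟩
  | mul x y hx hy h h' =>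
    obtain ⟨b, hb⟩ := h
    obtain ⟨c, hc⟩ := h'
    exact ⟨c * b, hb.mul hc⟩

/-- The adjoint of an integro-differential operator. -/
def adj (a : I1 K) : I1 K := Classical.choose (exists_isAdj a)

theorem adj_spec (a : I1 K) :
    IsAdj (toEnd a) (toEnd (adj a)) :=
  Classical.choose_spec (exists_isAdj a)

theorem adj_eq {a b : I1 K} (h : IsAdj (toEnd a) (toEnd b)) :
    adj a = b :=
  toEnd_injective ((adj_spec a).unique h)

theorem adj_adj (a : I1 K) : adj (adj a) = a := adj_eq (adj_spec a).symm

theorem adj_mul (a b : I1 K) : adj (a * b) = adj b * adj a :=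
  adj_eq ((adj_spec a).mul (adj_spec b))

theorem adj_add (a b : I1 K) : adj (a + b) = adj a + adj b :=
  adj_eq ((adj_spec a).add (adj_spec b))

theorem adj_algebraMap (r : K) : adj (algebraMap K (I1 K) r) = algebraMap K (I1 K) r :=
  adj_eq (isAdj_algebraMap r)

variable (K) in
/-- The involution `*` as an algebra isomorphism onto the opposite algebra. By the lemmas below
it is the one with `∂* = ∫`, `∫* = ∂`, `H* = H`, and `a** = a`. -/
def involution : I1 K ≃ₐ[K] (I1 K)ᵐᵒᵖ where
  toFun a := MulOpposite.op (adj a)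
  invFun b := adj b.unop
  left_inv a := adj_adj a
  right_inv b := by simp [adj_adj]
  map_mul' a b := by simp [adj_mul]
  map_add' a b := by simp [adj_add]
  commutes' r := by simp [adj_algebraMap, MulOpposite.algebraMap_apply]

/-- The image of an element under the involution. -/
def invol (a : I1 K) : I1 K := (involution K a).unop

theorem invol_der : invol (der K) = int K := adj_eq isAdj_der_int

theorem invol_int : invol (int K) = der K := adj_eq isAdj_der_int.symm

theorem invol_H : invol (H K) = H K := adj_eq isAdj_H

theorem invol_invol (a : I1 K) : invol (invol a) = a := adj_adj a

/-! ### The right action on `K[∂]` -/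

theorem e_zero_mul_int (i : ℕ) : e K 0 0 * der K ^ (i + 1) * int K = e K 0 0 * der K ^ i := by
  rw [pow_succ, mul_assoc, mul_assoc, der_mul_int, mul_one]

theorem e_zero_mul_int_zero : e K 0 0 * int K = 0 := by
  rw [e, sub_mul, zero_add, pow_zero, pow_zero, pow_one, pow_one, mul_one, one_mul, mul_assoc,
    der_mul_int, mul_one, sub_self]

theorem H_eq : H K = mulX K * der K + 1 := by
  refine toEnd_injective (LinearMap.ext fun p => ?_)
  have h1 : toEnd (H K) p = derivative (X * p) := rfl
  have h2 : toEnd (mulX K * der K) p = X * derivative p := rfl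
  rw [map_add, LinearMap.add_apply, h1, h2, map_one, Module.End.one_apply, derivative_mul,
    derivative_X, one_mul, add_comm]

theorem der_mul_H : der K * H K = H K * der K + der K := by
  have : der K * H K = der K * (mulX K * der K + 1) := congrArg (der K * ·) H_eq
  rw [this, mul_add, ← mul_assoc, mul_one, ← H]

theorem e_zero_mul_H_zero : e K 0 0 * H K = e K 0 0 := by
  rw [H_eq, mul_add, mul_one, mulX_eq, ← mul_assoc, ← mul_assoc, e_zero_mul_int_zero, zero_mul,
    zero_mul, zero_add]

theorem e_zero_mul_H (i : ℕ) :
    e K 0 0 * der K ^ i * H K = ((i : K) + 1) • (e K 0 0 * der K ^ i) :=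
  mul_pow_mul_eq der_mul_H e_zero_mul_H_zero i

end PolyIntDiff

end

open PolyIntDiff

noncomputable section
namespace PolyIntDiff

/-! ### Commutation relations for `∂`, `∫` and polynomials in `H` -/

variable {K : Type*} [Field K]

/-! Everything is read off from one faithful right module. The row space `e₀₀ K[∂]`, a copy of `P'`,
is all of `e₀₀ I₁` (`e_zero_mul_mem_range`), and an operator `r` is determined by its rows `e₀₀ ∂^j
r`, since these recover the coefficients of the polynomials `r q`. Hence `a` is left regular exactly
when it kills no nonzero row (`mem_leftRegularElements_iff`), and `∂^i a` is left regular exactly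
when `a` kills no nonzero row supported in degrees `≥ i`.

An element of `Γ` acts on rows almost triangularly: for `d > s` it maps `∂^d` to `a₀(d+1) ∂^d` plus
lower terms, because `∫^i` with `i ≥ 1` lowers degrees and `f` only produces degrees `≤ s`. So a
killed row has degree `≤ s` or degree in `R(a)`. Conversely, if `d ∈ R(a)`, then `a` maps the rows
of degree `≤ d` into those of degree `< d`, and a dimension count gives a killed row. The kernel
thus has degree at most `max R(a)`, or at most `s` when `R(a)` is empty, which turns regularity of
`∂^i a` into a finite test and yields the formulas for `d(a)`.

To reach every left regular `b`, multiply by the least power `∫^k` making `∫^k b` a canonical sum.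
Its `a₀` is nonzero: for `k > 0` one factor `∫` could otherwise be cancelled, and for `k = 0` every
large integer would be a root of `a₀`. So `∫^k b ∈ Γ`, and `b = ∂^k ∫^k b` gives the description of
the left regular elements. The involution reverses products and transfers it to the right. -/

theorem der_mul_aeval_H [CharZero K] (q : K[X]) :
    der K * aeval (H K) q = aeval (H K) (q.comp (X + 1)) * der K := by
  induction q using Polynomial.induction_on' with
  | add p q hp hq => simp only [map_add, add_comp, mul_add, add_mul, hp, hq]
  | monomial n c =>
    have h : SemiconjBy (der K) (H K) (H K + 1) := by
      rw [SemiconjBy, der_mul_H, add_mul, one_mul]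
    have := (h.pow_right n).eq
    rw [← C_mul_X_pow_eq_monomial]
    simp only [map_mul, map_pow, aeval_C, aeval_X, mul_comp, C_comp, pow_comp, X_comp, map_add,
      map_one]
    rw [← mul_assoc, ← Algebra.commutes, mul_assoc, this, mul_assoc]

theorem aeval_H_mul_der [CharZero K] (q : K[X]) :
    aeval (H K) q * der K = der K * aeval (H K) (q.comp (X - 1)) := by
  rw [der_mul_aeval_H, comp_assoc]
  simp

theorem H_mul_int [CharZero K] : H K * int K = int K * (H K + 1) := by
  have h := congrArg adj (der_mul_H (K := K))
  rw [adj_add, adj_mul, adj_mul] at h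
  have h1 : adj (der K) = int K := invol_der
  have h2 : adj (H K) = H K := invol_H
  rw [h1, h2] at h
  rw [h, mul_add, mul_one]

theorem aeval_H_mul_int [CharZero K] (q : K[X]) :
    aeval (H K) q * int K = int K * aeval (H K) (q.comp (X + 1)) := by
  induction q using Polynomial.induction_on' with
  | add p q hp hq => simp only [map_add, add_comp, mul_add, add_mul, hp, hq]
  | monomial n c =>
    have h : SemiconjBy (int K) (H K + 1) (H K) := H_mul_int.symm
    have := (h.pow_right n).eq
    rw [← C_mul_X_pow_eq_monomial]
    simp only [map_mul, map_pow, aeval_C, aeval_X, mul_comp, C_comp, pow_comp, X_comp, map_add,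
      map_one]
    rw [mul_assoc, ← this, ← mul_assoc, Algebra.commutes, mul_assoc]

/-! ### Matrix units and the rows `e₀₀ ∂^j` -/

theorem der_pow_mul_int_pow [CharZero K] (i : ℕ) : der K ^ i * int K ^ i = 1 := by
  induction i with
  | zero => simp
  | succ i ih =>
    rw [pow_succ, pow_succ', mul_assoc, ← mul_assoc (der K), der_mul_int, one_mul, ih]

theorem e_zero_zero : e K 0 0 = 1 - int K * der K := by simp [e]

theorem e_eq (i j : ℕ) : e K i j = int K ^ i * e K 0 0 * der K ^ j := by
  rw [e_zero_zero, e, mul_sub, sub_mul, mul_one, pow_succ, pow_succ']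
  simp only [mul_assoc]

theorem der_mul_e_zero [CharZero K] : der K * e K 0 0 = 0 := by
  rw [e_zero_zero, mul_sub, ← mul_assoc, der_mul_int]
  simp

theorem e_zero_mul_e_zero [CharZero K] : e K 0 0 * e K 0 0 = e K 0 0 := by
  conv_lhs => enter [1]; rw [e_zero_zero]
  rw [sub_mul, mul_assoc, der_mul_e_zero, mul_zero, one_mul, sub_zero]

theorem e_zero_mul_int_pow [CharZero K] {n : ℕ} (hn : n ≠ 0) : e K 0 0 * int K ^ n = 0 := by
  obtain ⟨n, rfl⟩ := Nat.exists_eq_succ_of_ne_zero hn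
  rw [Nat.succ_eq_add_one, pow_succ', ← mul_assoc, e_zero_mul_int_zero, zero_mul]

theorem der_pow_mul_e_zero [CharZero K] {n : ℕ} (hn : n ≠ 0) : der K ^ n * e K 0 0 = 0 := by
  obtain ⟨n, rfl⟩ := Nat.exists_eq_succ_of_ne_zero hn
  rw [Nat.succ_eq_add_one, pow_succ, mul_assoc, der_mul_e_zero, mul_zero]

theorem e_zero_mul_der_pow_mul_int_pow_of_le [CharZero K] {i j : ℕ} (h : i ≤ j) :
    e K 0 0 * der K ^ j * int K ^ i = e K 0 0 * der K ^ (j - i) := by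
  obtain ⟨k, rfl⟩ := Nat.exists_eq_add_of_le' h
  rw [pow_add, mul_assoc, mul_assoc, der_pow_mul_int_pow, mul_one, Nat.add_sub_cancel]

theorem e_zero_mul_der_pow_mul_int_pow_of_lt [CharZero K] {i j : ℕ} (h : j < i) :
    e K 0 0 * der K ^ j * int K ^ i = 0 := by
  obtain ⟨k, rfl⟩ := Nat.exists_eq_add_of_lt h
  rw [add_assoc, pow_add, mul_assoc, ← mul_assoc (der K ^ j), der_pow_mul_int_pow, one_mul,
    e_zero_mul_int_pow (Nat.succ_ne_zero k)]

theorem e_zero_mul_der_pow_mul_int_pow_mul_e_zero [CharZero K] (i j : ℕ) :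
    e K 0 0 * der K ^ j * int K ^ i * e K 0 0 = if j = i then e K 0 0 else 0 := by
  rcases lt_trichotomy j i with h | rfl | h
  · rw [e_zero_mul_der_pow_mul_int_pow_of_lt h, zero_mul, if_neg h.ne]
  · rw [e_zero_mul_der_pow_mul_int_pow_of_le le_rfl, Nat.sub_self, pow_zero, mul_one,
      e_zero_mul_e_zero, if_pos rfl]
  · rw [e_zero_mul_der_pow_mul_int_pow_of_le h.le, mul_assoc,
      der_pow_mul_e_zero (Nat.sub_ne_zero_of_lt h), mul_zero, if_neg h.ne']

theorem e_zero_mul_der_pow_mul_e [CharZero K] (i j k : ℕ) :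
    e K 0 0 * der K ^ j * e K i k = if j = i then e K 0 0 * der K ^ k else 0 := by
  rw [e_eq i k, ← mul_assoc, ← mul_assoc, e_zero_mul_der_pow_mul_int_pow_mul_e_zero, ite_mul,
    zero_mul]

theorem e_zero_mul_der_pow_mul_aeval_H [CharZero K] (j : ℕ) (q : K[X]) :
    e K 0 0 * der K ^ j * aeval (H K) q = q.eval ((j : K) + 1) • (e K 0 0 * der K ^ j) := by
  induction q using Polynomial.induction_on' with
  | add p q hp hq => rw [map_add, mul_add, hp, hq, eval_add, add_smul]
  | monomial n c =>
    rw [← C_mul_X_pow_eq_monomial, ← smul_eq_C_mul, map_smul, map_pow, aeval_X, mul_smul_comm,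
      eval_smul, smul_eq_mul, mul_smul, eval_pow, eval_X]
    congr 1
    induction n with
    | zero => simp
    | succ n ih => rw [pow_succ, ← mul_assoc, ih, smul_mul_assoc, e_zero_mul_H, smul_smul, pow_succ]

/-- `e₀₀ = 1 - ∫∂`, and integration produces no constant term. -/
theorem toEnd_e_zero (q : K[X]) : (toEnd (e K 0 0) q).coeff 0 = q.coeff 0 := by
  have h : toEnd (e K 0 0) q = q - integration K (derivative q) := by rw [e_zero_zero]; rfl
  have h2 : ∀ q : K[X], (integration K q).coeff 0 = 0 := by
    intro q
    have : (lcoeff K 0).comp (integration K) = 0 := by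
      ext n
      simp [monomial_one_right_eq_X_pow, integration_X_pow]
    exact congrArg (fun L => L q) this
  rw [h, coeff_sub, h2, sub_zero]

theorem e_zero_ne_zero : e K 0 0 ≠ 0 := fun h => by
  have := toEnd_e_zero (1 : K[X])
  rw [h] at this
  simp at this

/-! ### Row vectors -/

variable (K) in
/-- The identification of `K[∂]` with `e₀₀ K[∂]`. -/
def rowMap : K[X] →ₗ[K] I1 K :=
  (LinearMap.mulLeft K (e K 0 0)).comp (aeval (der K)).toLinearMap

theorem rowMap_apply (q : K[X]) : rowMap K q = e K 0 0 * aeval (der K) q := rfl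

theorem rowMap_X_pow (j : ℕ) : rowMap K (X ^ j) = e K 0 0 * der K ^ j := by
  simp [rowMap_apply]

/-- Multiplication by `∫^i e₀₀` isolates one coefficient of a row; this makes `rowMap` injective. -/
theorem rowMap_mul_int_pow_mul_e_zero [CharZero K] (q : K[X]) (i : ℕ) :
    rowMap K q * int K ^ i * e K 0 0 = q.coeff i • e K 0 0 := by
  induction q using Polynomial.induction_on' with
  | add p q hp hq => rw [map_add, add_mul, add_mul, hp, hq, coeff_add, add_smul]
  | monomial n c =>
    rw [← C_mul_X_pow_eq_monomial, ← smul_eq_C_mul, map_smul, rowMap_X_pow, smul_mul_assoc,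
      smul_mul_assoc, e_zero_mul_der_pow_mul_int_pow_mul_e_zero, coeff_smul, coeff_X_pow]
    simp [eq_comm (a := n)]

theorem rowMap_injective [CharZero K] : Function.Injective (rowMap K) := by
  rw [injective_iff_map_eq_zero]
  intro q hq
  ext i
  have h := rowMap_mul_int_pow_mul_e_zero q i
  rw [hq, zero_mul, zero_mul] at h
  simpa [e_zero_ne_zero] using h.symm

theorem rowMap_mul_aeval_der (q r : K[X]) :
    rowMap K q * aeval (der K) r = rowMap K (q * r) := by
  rw [rowMap_apply, rowMap_apply, map_mul, mul_assoc]

theorem aeval_der_injective [CharZero K] : Function.Injective (aeval (der K) : K[X] → I1 K) :=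
  fun p q h => rowMap_injective (by rw [rowMap_apply, rowMap_apply]; exact congrArg _ h)

/-- Row vectors of degree less than `d`. -/
def rowLT (K : Type*) [Field K] (d : ℕ) : Submodule K (I1 K) := (degreeLT K d).map (rowMap K)

theorem rowLT_mono {m n : ℕ} (h : m ≤ n) : rowLT K m ≤ rowLT K n :=
  Submodule.map_mono (degreeLT_mono h)

theorem e_zero_mul_der_pow_mem_rowLT {j d : ℕ} (h : j < d) : e K 0 0 * der K ^ j ∈ rowLT K d := by
  rw [← rowMap_X_pow]
  refine Submodule.mem_map_of_mem (mem_degreeLT.2 ?_)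
  rw [degree_X_pow]
  exact_mod_cast h

theorem rowLT_le_range (d : ℕ) : rowLT K d ≤ LinearMap.range (rowMap K) := by
  rintro _ ⟨q, -, rfl⟩
  exact ⟨q, rfl⟩

/-! ### The finite-rank part and its size -/

theorem exists_mem_FLe {f : I1 K} (hf : f ∈ F K) : ∃ m, f ∈ FLe K m := by
  have mono : ∀ {m n : ℕ}, m ≤ n → FLe K m ≤ FLe K n := fun h =>
    Submodule.span_mono fun y ⟨i, j, hi, hj, hy⟩ => ⟨i, j, hi.trans h, hj.trans h, hy⟩
  induction hf using Submodule.span_induction with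
  | mem x hx =>
    obtain ⟨⟨i, j⟩, rfl⟩ := hx
    exact ⟨max i j, Submodule.subset_span ⟨i, j, le_max_left _ _, le_max_right _ _, rfl⟩⟩
  | zero => exact ⟨0, zero_mem _⟩
  | add x y _ _ hx hy =>
    obtain ⟨m, hm⟩ := hx
    obtain ⟨n, hn⟩ := hy
    exact ⟨max m n, add_mem (mono (le_max_left _ _) hm) (mono (le_max_right _ _) hn)⟩
  | smul c x _ hx =>
    obtain ⟨m, hm⟩ := hx
    exact ⟨m, Submodule.smul_mem _ c hm⟩

theorem neg_one_le_size (f : I1 K) : -1 ≤ size f := by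
  unfold size
  split_ifs <;> omega

theorem size_cases {f : I1 K} (hf : f ∈ F K) :
    f = 0 ∨ ∃ m : ℕ, size f = m ∧ f ∈ FLe K m := by
  by_cases h : f = 0
  · exact Or.inl h
  · exact Or.inr ⟨_, if_neg h, Nat.sInf_mem (s := {m | f ∈ FLe K m}) (exists_mem_FLe hf)⟩

/-- As a matrix, `f` has no nonzero column beyond its size, so the bound on the degree does not
depend on `j`. -/
theorem e_zero_mul_der_pow_mul_mem_rowLT [CharZero K] {f : I1 K} (hf : f ∈ F K) (j : ℕ) {d : ℕ}
    (hd : size f < d) : e K 0 0 * der K ^ j * f ∈ rowLT K d := by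
  rcases size_cases hf with rfl | ⟨m, hm, hfm⟩
  · rw [mul_zero]; exact zero_mem _
  · have hd' : m < d := by omega
    suffices FLe K m ≤ (rowLT K d).comap (LinearMap.mulLeft K (e K 0 0 * der K ^ j)) from this hfm
    refine Submodule.span_le.2 ?_
    rintro _ ⟨i, k, -, hk, rfl⟩
    simp only [Submodule.comap_coe, Set.mem_preimage, LinearMap.mulLeft_apply, SetLike.mem_coe,
      e_zero_mul_der_pow_mul_e]
    split_ifs
    · exact e_zero_mul_der_pow_mem_rowLT (hk.trans_lt hd')
    · exact zero_mem _

/-! ### Canonical sums -/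

theorem int_mul_e (i j : ℕ) : int K * e K i j = e K (i + 1) j := by
  rw [e_eq i, e_eq (i + 1), pow_succ', mul_assoc, mul_assoc, mul_assoc]

theorem e_mul_der (i j : ℕ) : e K i j * der K = e K i (j + 1) := by
  rw [e_eq i j, e_eq i (j + 1), pow_succ, mul_assoc, mul_assoc]

theorem int_mul_mem_F {f : I1 K} (hf : f ∈ F K) : int K * f ∈ F K := by
  suffices F K ≤ (F K).comap (LinearMap.mulLeft K (int K)) from this hf
  refine Submodule.span_le.2 ?_
  rintro _ ⟨⟨i, j⟩, rfl⟩
  simp only [Submodule.comap_coe, Set.mem_preimage, LinearMap.mulLeft_apply, SetLike.mem_coe,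
    int_mul_e]
  exact Submodule.subset_span ⟨(i + 1, j), rfl⟩

theorem der_mul_mem_F [CharZero K] {f : I1 K} (hf : f ∈ F K) : der K * f ∈ F K := by
  suffices F K ≤ (F K).comap (LinearMap.mulLeft K (der K)) from this hf
  refine Submodule.span_le.2 ?_
  rintro _ ⟨⟨i, j⟩, rfl⟩
  simp only [Submodule.comap_coe, Set.mem_preimage, LinearMap.mulLeft_apply, SetLike.mem_coe]
  rcases i with _ | i
  · rw [e_eq, pow_zero, one_mul, ← mul_assoc, der_mul_e_zero, zero_mul]
    exact zero_mem _
  · refine Submodule.subset_span ⟨(i, j), ?_⟩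
    simp only
    rw [e_eq (i + 1), pow_succ', ← mul_assoc, ← mul_assoc, ← mul_assoc, der_mul_int, one_mul, e_eq]

theorem mul_der_mem_F {f : I1 K} (hf : f ∈ F K) : f * der K ∈ F K := by
  suffices F K ≤ (F K).comap (LinearMap.mulRight K (der K)) from this hf
  refine Submodule.span_le.2 ?_
  rintro _ ⟨⟨i, j⟩, rfl⟩
  simp only [Submodule.comap_coe, Set.mem_preimage, LinearMap.mulRight_apply, SetLike.mem_coe,
    e_mul_der]
  exact Submodule.subset_span ⟨(i, j + 1), rfl⟩

theorem mul_int_mem_F [CharZero K] {f : I1 K} (hf : f ∈ F K) : f * int K ∈ F K := by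
  suffices F K ≤ (F K).comap (LinearMap.mulRight K (int K)) from this hf
  refine Submodule.span_le.2 ?_
  rintro _ ⟨⟨i, j⟩, rfl⟩
  simp only [Submodule.comap_coe, Set.mem_preimage, LinearMap.mulRight_apply, SetLike.mem_coe]
  rcases j with _ | j
  · rw [e_eq, pow_zero, mul_one, mul_assoc, e_zero_mul_int_zero, mul_zero]
    exact zero_mem _
  · refine Submodule.subset_span ⟨(i, j), ?_⟩
    simp only
    rw [e_eq i (j + 1), pow_succ, mul_assoc, mul_assoc (der K ^ j), der_mul_int, mul_one, e_eq]

theorem e_mul_aeval_H [CharZero K] (i j : ℕ) (q : K[X]) :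
    e K i j * aeval (H K) q = q.eval ((j : K) + 1) • e K i j := by
  rw [e_eq, mul_assoc (int K ^ i), mul_assoc, e_zero_mul_der_pow_mul_aeval_H, mul_smul_comm]

theorem mul_aeval_H_mem_F [CharZero K] {f : I1 K} (hf : f ∈ F K) (q : K[X]) :
    f * aeval (H K) q ∈ F K := by
  suffices F K ≤ (F K).comap (LinearMap.mulRight K (aeval (H K) q)) from this hf
  refine Submodule.span_le.2 ?_
  rintro _ ⟨⟨i, j⟩, rfl⟩
  simp only [Submodule.comap_coe, Set.mem_preimage, LinearMap.mulRight_apply, SetLike.mem_coe,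
    e_mul_aeval_H]
  exact Submodule.smul_mem _ _ (Submodule.subset_span ⟨(i, j), rfl⟩)

variable (K) in
/-- The sum `∑ i, ∫^i p_i(H)`. -/
def intPart : (ℕ →₀ K[X]) →ₗ[K] I1 K :=
  Finsupp.lsum K fun i => (LinearMap.mulLeft K (int K ^ i)).comp (aeval (H K)).toLinearMap

theorem intPart_single (i : ℕ) (q : K[X]) :
    intPart K (Finsupp.single i q) = int K ^ i * aeval (H K) q := by
  simp [intPart]

theorem canonicalSum_eq (p : ℕ →₀ K[X]) (f : I1 K) : canonicalSum p f = intPart K p + f := rfl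

variable (K) in
/-- The subspace of all canonical sums. -/
def canonicalSums : Submodule K (I1 K) := LinearMap.range (intPart K) ⊔ F K

theorem mem_canonicalSums {a : I1 K} :
    a ∈ canonicalSums K ↔ ∃ p, ∃ f ∈ F K, a = canonicalSum p f := by
  simp only [canonicalSums, Submodule.mem_sup, LinearMap.mem_range, canonicalSum_eq]
  constructor
  · rintro ⟨_, ⟨p, rfl⟩, f, hf, rfl⟩
    exact ⟨p, f, hf, rfl⟩
  · rintro ⟨p, f, hf, rfl⟩
    exact ⟨_, ⟨p, rfl⟩, f, hf, rfl⟩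

theorem int_pow_mul_aeval_H_mem (i : ℕ) (q : K[X]) :
    int K ^ i * aeval (H K) q ∈ canonicalSums K :=
  Submodule.mem_sup_left ⟨_, intPart_single i q⟩

theorem canonicalSums_le {S : Submodule K (I1 K)} 
    (h : ∀ (i : ℕ) (q : K[X]), int K ^ i * aeval (H K) q ∈ S)
    (hF : F K ≤ S) : canonicalSums K ≤ S := by
  refine sup_le ?_ hF
  rintro _ ⟨p, rfl⟩
  induction p using Finsupp.induction_linear with
  | zero => rw [map_zero]; exact zero_mem _
  | add p q hp hq => rw [map_add]; exact add_mem hp hq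
  | single i q => rw [intPart_single]; exact h i q

theorem int_mul_mem_canonicalSums {a : I1 K} (ha : a ∈ canonicalSums K) :
    int K * a ∈ canonicalSums K := by
  suffices canonicalSums K ≤ (canonicalSums K).comap (LinearMap.mulLeft K (int K)) from this ha
  refine canonicalSums_le (fun i q => ?_) fun f hf => Submodule.mem_sup_right (int_mul_mem_F hf)
  simp only [Submodule.mem_comap, LinearMap.mulLeft_apply]
  rw [← mul_assoc, ← pow_succ']
  exact int_pow_mul_aeval_H_mem _ _

theorem int_pow_mul_mem_canonicalSums {a : I1 K} (ha : a ∈ canonicalSums K) (n : ℕ) :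
    int K ^ n * a ∈ canonicalSums K := by
  induction n with
  | zero => simpa
  | succ n ih => rw [pow_succ', mul_assoc]; exact int_mul_mem_canonicalSums ih

theorem mul_H_mem_canonicalSums [CharZero K] {a : I1 K} (ha : a ∈ canonicalSums K) :
    a * H K ∈ canonicalSums K := by
  suffices canonicalSums K ≤ (canonicalSums K).comap (LinearMap.mulRight K (H K)) from this ha
  refine canonicalSums_le (fun i q => ?_) fun f hf => Submodule.mem_sup_right ?_
  · simp only [Submodule.mem_comap, LinearMap.mulRight_apply]
    have h := int_pow_mul_aeval_H_mem i (q * X)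
    rwa [map_mul, aeval_X, ← mul_assoc] at h
  · simpa using mul_aeval_H_mem_F hf X

theorem mul_int_mem_canonicalSums [CharZero K] {a : I1 K} (ha : a ∈ canonicalSums K) :
    a * int K ∈ canonicalSums K := by
  suffices canonicalSums K ≤ (canonicalSums K).comap (LinearMap.mulRight K (int K)) from this ha
  refine canonicalSums_le (fun i q => ?_) fun f hf => Submodule.mem_sup_right (mul_int_mem_F hf)
  simp only [Submodule.mem_comap, LinearMap.mulRight_apply]
  rw [mul_assoc, aeval_H_mul_int, ← mul_assoc, ← pow_succ]
  exact int_pow_mul_aeval_H_mem _ _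

/-- The factor `∫` on the left absorbs the new `∂`: `∫^(i+1) q(H) ∂ = ∫^i (1 - e₀₀) q(H-1)`, and the
`e₀₀` term lies in `F`. Without it, a term `q(H) ∂` would remain. -/
theorem int_mul_mul_der_mem_canonicalSums [CharZero K] {a : I1 K} (ha : a ∈ canonicalSums K) :
    int K * a * der K ∈ canonicalSums K := by
  suffices canonicalSums K ≤ (canonicalSums K).comap
      ((LinearMap.mulRight K (der K)).comp (LinearMap.mulLeft K (int K))) from this ha
  refine canonicalSums_le (fun i q => ?_) fun f hf =>
    Submodule.mem_sup_right (mul_der_mem_F (int_mul_mem_F hf))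
  simp only [Submodule.mem_comap, LinearMap.comp_apply, LinearMap.mulRight_apply,
    LinearMap.mulLeft_apply]
  have h : int K * der K = 1 - e K 0 0 := by rw [e_zero_zero, sub_sub_cancel]
  rw [← mul_assoc, ← pow_succ', mul_assoc, aeval_H_mul_der, pow_succ, mul_assoc, ← mul_assoc (int K),
    h, sub_mul, one_mul, mul_sub, ← mul_assoc]
  refine sub_mem (int_pow_mul_aeval_H_mem _ _) (Submodule.mem_sup_right ?_)
  refine mul_aeval_H_mem_F (Submodule.subset_span ⟨(i, 0), ?_⟩) _
  simp only [e_eq i 0, pow_zero, mul_one]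

/-- Each right factor `∂` costs one more `∫` on the left, while the other generators cost none. -/
theorem exists_int_pow_mul_mem_canonicalSums [CharZero K] (b : I1 K) :
    ∃ k, int K ^ k * b ∈ canonicalSums K := by
  -- Stated for `a * b` with arbitrary `a`, so that products of generators can be absorbed one
  -- factor at a time; the lemma is the case `a = 1`.
  have key : ∀ y ∈ I1Subalgebra K, ∀ b : I1 K, toEnd b = y → ∀ a : I1 K,
      (∃ k, int K ^ k * a ∈ canonicalSums K) → ∃ k, int K ^ k * (a * b) ∈ canonicalSums K := by
    intro y hy
    induction hy using Algebra.adjoin_induction with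
    | mem y hy =>
      rintro b hb a ⟨k, hk⟩
      rcases hy with rfl | rfl | rfl
      · obtain rfl : b = mulX K := toEnd_injective hb
        refine ⟨k, ?_⟩
        rw [mulX_eq, ← mul_assoc, ← mul_assoc]
        exact mul_H_mem_canonicalSums (mul_int_mem_canonicalSums hk)
      · obtain rfl : b = der K := toEnd_injective hb
        refine ⟨k + 1, ?_⟩
        rw [pow_succ', mul_assoc, ← mul_assoc _ a, ← mul_assoc]
        exact int_mul_mul_der_mem_canonicalSums hk
      · obtain rfl : b = int K := toEnd_injective hb
        refine ⟨k, ?_⟩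
        rw [← mul_assoc]
        exact mul_int_mem_canonicalSums hk
    | algebraMap r =>
      rintro b hb a ⟨k, hk⟩
      obtain rfl : b = algebraMap K (I1 K) r := toEnd_injective hb
      refine ⟨k, ?_⟩
      rw [← Algebra.commutes, ← Algebra.smul_def, mul_smul_comm]
      exact Submodule.smul_mem _ _ hk
    | add x y hx hy h h' =>
      intro b hb a ha
      let x' : I1 K := ⟨x, hx⟩
      let y' : I1 K := ⟨y, hy⟩
      obtain rfl : b = x' + y' := toEnd_injective hb
      obtain ⟨m, hm⟩ := h x' rfl a ha
      obtain ⟨n, hn⟩ := h' y' rfl a ha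
      refine ⟨m + n, ?_⟩
      rw [mul_add, mul_add]
      refine add_mem ?_ ?_
      · rw [add_comm, pow_add, mul_assoc]
        exact int_pow_mul_mem_canonicalSums hm n
      · rw [pow_add, mul_assoc]
        exact int_pow_mul_mem_canonicalSums hn m
    | mul x y hx hy h h' =>
      intro b hb a ha
      let x' : I1 K := ⟨x, hx⟩
      let y' : I1 K := ⟨y, hy⟩
      obtain rfl : b = x' * y' := toEnd_injective hb
      have := h' y' rfl _ (h x' rfl a ha)
      rwa [mul_assoc] at this
  have := key _ b.2 b rfl 1 ⟨0, by simpa using int_pow_mul_aeval_H_mem (K := K) 0 1⟩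
  rwa [one_mul] at this

/-- With no `a₀`, every remaining power of `∫` has a factor for `∂` to cancel. -/
theorem der_mul_canonicalSum_mem [CharZero K] {p : ℕ →₀ K[X]} {f : I1 K} (hp : p 0 = 0)
    (hf : f ∈ F K) : der K * canonicalSum p f ∈ canonicalSums K := by
  rw [canonicalSum_eq, mul_add]
  refine add_mem ?_ (Submodule.mem_sup_right (der_mul_mem_F hf))
  rw [intPart, Finsupp.lsum_apply, Finsupp.sum, Finset.mul_sum]
  refine sum_mem fun i hi => ?_
  rcases i with _ | i
  · exact absurd hp (Finsupp.mem_support_iff.1 hi)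
  · simp only [LinearMap.comp_apply, LinearMap.mulLeft_apply, AlgHom.toLinearMap_apply]
    rw [← mul_assoc, pow_succ', ← mul_assoc, der_mul_int, one_mul]
    exact int_pow_mul_aeval_H_mem _ _

/-! ### The action of canonical sums on row vectors -/

/-- Triangularity: for `i ≥ 1` the term with `∫^i` lowers the degree by `i` or kills the row, so
only `a₀` acts on the diagonal, through `H ↦ j + 1`. -/
theorem e_zero_mul_der_pow_mul_intPart [CharZero K] (p : ℕ →₀ K[X]) (j : ℕ) :
    e K 0 0 * der K ^ j * intPart K p - (p 0).eval ((j : K) + 1) • (e K 0 0 * der K ^ j) ∈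
      rowLT K j := by
  induction p using Finsupp.induction_linear with
  | zero => simp
  | add p q hp hq =>
    rw [map_add, mul_add, Finsupp.add_apply, eval_add, add_smul, add_sub_add_comm]
    exact add_mem hp hq
  | single i q =>
    rw [intPart_single, ← mul_assoc]
    rcases i with _ | i
    · simp [e_zero_mul_der_pow_mul_aeval_H]
    · rw [Finsupp.single_eq_of_ne (by simp), eval_zero, zero_smul, sub_zero]
      rcases lt_or_ge j (i + 1) with h | h
      · rw [e_zero_mul_der_pow_mul_int_pow_of_lt h, zero_mul]
        exact zero_mem _
      · rw [e_zero_mul_der_pow_mul_int_pow_of_le h, e_zero_mul_der_pow_mul_aeval_H]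
        exact Submodule.smul_mem _ _ (e_zero_mul_der_pow_mem_rowLT (by omega))

theorem e_zero_mul_der_pow_mul_intPart_mem [CharZero K] (p : ℕ →₀ K[X]) {j d : ℕ} (h : j < d) :
    e K 0 0 * der K ^ j * intPart K p ∈ rowLT K d := by
  have := add_mem (rowLT_mono h.le (e_zero_mul_der_pow_mul_intPart p j))
    (Submodule.smul_mem _ ((p 0).eval ((j : K) + 1)) (e_zero_mul_der_pow_mem_rowLT (K := K) h))
  rwa [sub_add_cancel] at this

theorem rowMap_mul_canonicalSum_mem [CharZero K] (p : ℕ →₀ K[X]) {f : I1 K} (hf : f ∈ F K) {d : ℕ}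
    (hd : size f < d) {q : K[X]} (hq : q ∈ degreeLT K d) :
    rowMap K q * canonicalSum p f ∈ rowLT K d := by
  classical
  suffices degreeLT K d ≤ (rowLT K d).comap
      ((LinearMap.mulRight K (canonicalSum p f)).comp (rowMap K)) from this hq
  rw [degreeLT_eq_span_X_pow, Submodule.span_le]
  intro _ hj
  simp only [Finset.coe_image, Set.mem_image, Finset.coe_range, Set.mem_Iio] at hj
  obtain ⟨j, hj, rfl⟩ := hj
  simp only [Submodule.comap_coe, Set.mem_preimage, LinearMap.comp_apply, LinearMap.mulRight_apply,
    SetLike.mem_coe, rowMap_X_pow, canonicalSum_eq, mul_add]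
  exact add_mem (e_zero_mul_der_pow_mul_intPart_mem p hj) (e_zero_mul_der_pow_mul_mem_rowLT hf j hd)

theorem rowMap_mul_canonicalSum_sub_mem [CharZero K] (p : ℕ →₀ K[X]) {f : I1 K} (hf : f ∈ F K)
    {d : ℕ} (hd : size f < d) {q : K[X]} (hq : q ∈ degreeLT K (d + 1)) :
    rowMap K q * canonicalSum p f -
      (q.coeff d * (p 0).eval ((d : K) + 1)) • rowMap K (X ^ d) ∈ rowLT K d := by
  -- Split off the top term: the remainder stays below degree `d`, and the top term contributes the
  -- diagonal entry.
  have hr : q - q.coeff d • X ^ d ∈ degreeLT K d := by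
    rw [mem_degreeLT, degree_lt_iff_coeff_zero]
    intro m hm
    rcases hm.eq_or_lt with rfl | hm
    · simp
    · rw [mem_degreeLT, degree_lt_iff_coeff_zero] at hq
      rw [coeff_sub, hq m hm, coeff_smul, coeff_X_pow, if_neg hm.ne', smul_zero, sub_zero]
  have h1 := rowMap_mul_canonicalSum_mem p hf hd hr
  have h2 := add_mem (e_zero_mul_der_pow_mul_intPart p d)
    (e_zero_mul_der_pow_mul_mem_rowLT hf d hd)
  have h3 := add_mem h1 (Submodule.smul_mem _ (q.coeff d) h2)
  convert h3 using 1
  simp only [map_sub, map_smul, rowMap_X_pow, canonicalSum_eq, mul_add, sub_mul, smul_mul_assoc,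
    smul_add, smul_sub, smul_smul]
  abel

theorem natDegree_of_rowMap_mul_eq_zero [CharZero K] {p : ℕ →₀ K[X]} {f : I1 K} (hf : f ∈ F K)
    {q : K[X]} (hq : q ≠ 0) (h : rowMap K q * canonicalSum p f = 0) :
    (q.natDegree : ℤ) ≤ size f ∨ q.natDegree ∈ bigRoots (p 0) (size f) := by
  rw [or_iff_not_imp_left, not_le]
  intro hd
  refine ⟨?_, hd⟩
  have hmem : q ∈ degreeLT K (q.natDegree + 1) := by
    rw [mem_degreeLT, degree_eq_natDegree hq]
    exact_mod_cast Nat.lt_succ_self _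
  have h1 := rowMap_mul_canonicalSum_sub_mem p hf hd hmem
  rw [h, zero_sub, neg_mem_iff, ← map_smul] at h1
  obtain ⟨t, ht, hte⟩ := h1
  rw [rowMap_injective hte, SetLike.mem_coe, mem_degreeLT, degree_lt_iff_coeff_zero] at ht
  have := ht _ le_rfl
  rw [coeff_smul, coeff_X_pow_self, smul_eq_mul, mul_one, mul_eq_zero] at this
  exact this.resolve_left (by simpa using hq)

/-- The diagonal entry at `d` vanishes, so a space of dimension `d + 1` is mapped into one of
dimension at most `d`. -/
theorem exists_rowMap_mul_eq_zero [CharZero K] {p : ℕ →₀ K[X]} {f : I1 K} (hf : f ∈ F K) {d : ℕ}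
    (hd : d ∈ bigRoots (p 0) (size f)) : ∃ q ≠ 0, rowMap K q * canonicalSum p f = 0 := by
  obtain ⟨h0, hd⟩ := hd
  let g : degreeLT K (d + 1) →ₗ[K] rowLT K d :=
    LinearMap.codRestrict _
      (((LinearMap.mulRight K (canonicalSum p f)).comp (rowMap K)).comp (Submodule.subtype _))
      (fun q => by
        have := rowMap_mul_canonicalSum_sub_mem p hf hd q.2
        rwa [h0, mul_zero, zero_smul, sub_zero] at this)
  have fr : ∀ n, Module.finrank K (degreeLT K n) = n := fun n => by
    rw [(degreeLTEquiv K n).finrank_eq, Module.finrank_fin_fun]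
  have : ∀ n, Module.Finite K (degreeLT K n) := fun n =>
    Module.Finite.equiv (degreeLTEquiv K n).symm
  have : Module.Finite K (rowLT K d) := inferInstanceAs (Module.Finite K (Submodule.map _ _))
  have hlt : Module.finrank K (rowLT K d) < Module.finrank K (degreeLT K (d + 1)) := by
    have : Module.finrank K (rowLT K d) ≤ Module.finrank K (degreeLT K d) :=
      Submodule.finrank_map_le _ _
    rw [fr] at this ⊢
    omega
  obtain ⟨q, hq, hq0⟩ := (Submodule.ne_bot_iff _).1 (LinearMap.ker_ne_bot_of_finrank_lt (f := g) hlt)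
  exact ⟨q, fun h => hq0 (Subtype.ext h), congrArg Subtype.val (LinearMap.mem_ker.1 hq)⟩

/-! ### Left regularity in terms of row vectors -/

theorem e_zero_mul_mem_range [CharZero K] (r : I1 K) :
    e K 0 0 * r ∈ LinearMap.range (rowMap K) := by
  obtain ⟨k, hk⟩ := exists_int_pow_mul_mem_canonicalSums r
  obtain ⟨p, f, hf, h⟩ := mem_canonicalSums.1 hk
  -- Inserting `∂^k ∫^k = 1` replaces `r` by a canonical sum, whose action on rows is known.
  have h1 : e K 0 0 * r = e K 0 0 * der K ^ k * canonicalSum p f := by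
    rw [← h, mul_assoc, ← mul_assoc (der K ^ k), der_pow_mul_int_pow, one_mul]
  rw [h1, canonicalSum_eq, mul_add]
  refine add_mem (rowLT_le_range _ (e_zero_mul_der_pow_mul_intPart_mem p (Nat.lt_succ_self k)))
    (rowLT_le_range ((size f).toNat + 1) (e_zero_mul_der_pow_mul_mem_rowLT hf k ?_))
  omega

theorem toEnd_der_pow (j : ℕ) (q : K[X]) : toEnd (der K ^ j) q = derivative^[j] q := by
  rw [map_pow, Module.End.pow_apply]
  rfl

/-- The constant term of `e₀₀ ∂^j r q` is `j!` times the coefficient of `x^j` in `r q`, and `j!` is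
invertible in characteristic zero. -/
theorem eq_zero_of_e_zero_mul_der_pow_mul [CharZero K] {r : I1 K}
    (h : ∀ j, e K 0 0 * der K ^ j * r = 0) : r = 0 := by
  refine toEnd_injective (LinearMap.ext fun q => Polynomial.ext fun j => ?_)
  have h1 : toEnd (e K 0 0 * der K ^ j * r) q =
      toEnd (e K 0 0) (toEnd (der K ^ j) (toEnd r q)) := by
    rw [map_mul, map_mul]; rfl
  have h2 := toEnd_e_zero (toEnd (der K ^ j) (toEnd r q))
  rw [← h1, h, toEnd_der_pow, coeff_iterate_derivative] at h2
  simp only [map_zero, LinearMap.zero_apply, coeff_zero, zero_add, Nat.descFactorial_self,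
    nsmul_eq_mul] at h2 ⊢
  exact (mul_eq_zero.1 h2.symm).resolve_left (Nat.cast_ne_zero.2 j.factorial_ne_zero)

theorem mem_leftRegularElements_iff [CharZero K] {a : I1 K} :
    a ∈ leftRegularElements (I1 K) ↔ ∀ q, rowMap K q * a = 0 → q = 0 := by
  constructor
  · intro h q hq
    exact rowMap_injective ((h _ hq).trans (map_zero _).symm)
  · intro h r hr
    refine eq_zero_of_e_zero_mul_der_pow_mul fun j => ?_
    obtain ⟨q, hq⟩ := e_zero_mul_mem_range (der K ^ j * r)
    rw [← mul_assoc] at hq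
    rw [← hq, h q, map_zero]
    rw [hq, mul_assoc, hr, mul_zero]

/-- Multiplying a row by `∂^i` shifts its degrees, so the rows reaching `a` through `∂^i a` are
those divisible by `X ^ i`. -/
theorem der_pow_mul_mem_leftRegularElements_iff [CharZero K] {a : I1 K} {i : ℕ} :
    der K ^ i * a ∈ leftRegularElements (I1 K) ↔
      ∀ q : K[X], (∀ j, q.coeff j ≠ 0 → i ≤ j) → rowMap K q * a = 0 → q = 0 := by
  have key : ∀ q, rowMap K q * (der K ^ i * a) = rowMap K (q * X ^ i) * a := fun q => by
    rw [← rowMap_mul_aeval_der, map_pow, aeval_X, mul_assoc]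
  rw [mem_leftRegularElements_iff]
  constructor
  · intro h q hq hqa
    obtain ⟨t, rfl⟩ := X_pow_dvd_iff.2 fun j hj => not_not.1 fun hne => hj.not_ge (hq j hne)
    rw [mul_comm] at hqa
    rw [h t ((key t).trans hqa), mul_zero]
  · intro h q hq
    have := h (q * X ^ i) (fun j hj => ?_) ((key q).symm.trans hq)
    · exact (mul_eq_zero.1 this).resolve_right (pow_ne_zero _ X_ne_zero)
    · by_contra hlt
      exact hj (by rw [coeff_mul_X_pow', if_neg hlt])

/-- `∂^i` has the right inverse `∫^i`, hence is itself left regular. -/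
theorem der_pow_mul_mem_leftRegularElements [CharZero K] {a : I1 K}
    (ha : a ∈ leftRegularElements (I1 K)) (i : ℕ) :
    der K ^ i * a ∈ leftRegularElements (I1 K) := fun r hr => by
  have := ha (r * der K ^ i) (by rw [mul_assoc, hr])
  rw [← mul_one r, ← der_pow_mul_int_pow i, ← mul_assoc, this, zero_mul]

/-! ### Testing regularity on segments of `K[∂]` -/

theorem mem_derSegment {i : ℕ} {m : ℤ} {y : I1 K} :
    y ∈ derSegment K i m ↔
      ∃ q : K[X], (∀ j, q.coeff j ≠ 0 → i ≤ j ∧ (j : ℤ) ≤ m) ∧ aeval (der K) q = y := by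
  constructor
  · intro hy
    induction hy using Submodule.span_induction with
    | mem y hy =>
      obtain ⟨j, hij, hjm, rfl⟩ := hy
      refine ⟨X ^ j, fun k hk => ?_, by simp⟩
      rw [coeff_X_pow] at hk
      obtain rfl : k = j := by_contra fun h => hk (if_neg h)
      exact ⟨hij, hjm⟩
    | zero => exact ⟨0, by simp⟩
    | add x y _ _ hx hy =>
      obtain ⟨s, hs, rfl⟩ := hx
      obtain ⟨t, ht, rfl⟩ := hy
      refine ⟨s + t, fun j hj => ?_, map_add _ _ _⟩
      by_cases h : s.coeff j = 0
      · exact ht j fun h' => hj (by rw [coeff_add, h, h', add_zero])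
      · exact hs j h
    | smul c x _ hx =>
      obtain ⟨s, hs, rfl⟩ := hx
      refine ⟨c • s, fun j hj => hs j fun h => hj (by rw [coeff_smul, h, smul_zero]), map_smul _ _ _⟩
  · rintro ⟨q, hq, rfl⟩
    rw [aeval_eq_sum_range]
    refine sum_mem fun j _ => ?_
    by_cases h : q.coeff j = 0
    · rw [h, zero_smul]; exact zero_mem _
    · exact Submodule.smul_mem _ _ (Submodule.subset_span ⟨j, (hq j h).1, (hq j h).2, rfl⟩)

theorem kerRight_inf_derSegment_eq_bot_iff [CharZero K] {a : I1 K} {i : ℕ} {m : ℤ} :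
    kerRight a ⊓ derSegment K i m = ⊥ ↔
      ∀ q : K[X], (∀ j, q.coeff j ≠ 0 → i ≤ j ∧ (j : ℤ) ≤ m) → rowMap K q * a = 0 → q = 0 := by
  rw [Submodule.eq_bot_iff]
  constructor
  · intro h q hq hqa
    have := h (aeval (der K) q) ⟨⟨?_, hqa⟩, mem_derSegment.2 ⟨q, hq, rfl⟩⟩
    · exact aeval_der_injective (this.trans (map_zero _).symm)
    · exact aeval_mem_adjoin_singleton K (der K)
  · rintro h y ⟨⟨-, hya⟩, hy⟩
    obtain ⟨q, hq, rfl⟩ := mem_derSegment.1 hy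
    rw [h q hq hya, map_zero]

/-- If every killed row vector has degree at most `m`, then the regularity of `∂^i a` can be tested
on the segment from `i` to any `n ≥ m`. -/
theorem der_pow_mul_mem_leftRegularElements_iff_inf [CharZero K] {a : I1 K} {m n : ℤ} (hmn : m ≤ n)
    (hm : ∀ q : K[X], q ≠ 0 → rowMap K q * a = 0 → (q.natDegree : ℤ) ≤ m) {i : ℕ} :
    der K ^ i * a ∈ leftRegularElements (I1 K) ↔ kerRight a ⊓ derSegment K i n = ⊥ := by
  rw [der_pow_mul_mem_leftRegularElements_iff, kerRight_inf_derSegment_eq_bot_iff]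
  refine ⟨fun h q hq => h q fun j hj => (hq j hj).1, fun h q hq hqa => ?_⟩
  by_contra hne
  refine hne (h q (fun j hj => ⟨hq j hj, ?_⟩) hqa)
  have h1 := hm q hne hqa
  have h2 := le_natDegree_of_ne_zero hj
  omega

theorem der_pow_mul_mem_of_lt [CharZero K] {a : I1 K} {m : ℤ}
    (hm : ∀ q : K[X], q ≠ 0 → rowMap K q * a = 0 → (q.natDegree : ℤ) ≤ m) {i : ℕ} (hi : m < i) :
    der K ^ i * a ∈ leftRegularElements (I1 K) := by
  rw [der_pow_mul_mem_leftRegularElements_iff]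
  intro q hq hqa
  by_contra hne
  have h1 := hm q hne hqa
  have h2 := hq q.natDegree (by simpa using hne)
  omega

theorem isLeast_leftRegDegree {a : I1 K}
    (h : {i : ℕ | der K ^ i * a ∈ leftRegularElements (I1 K)}.Nonempty) :
    IsLeast {i : ℕ | der K ^ i * a ∈ leftRegularElements (I1 K)} (leftRegDegree a) :=
  ⟨Nat.sInf_mem h, fun _ hi => Nat.sInf_le hi⟩

/-- Serves both cases of the degree formula: `m = r` when there are roots beyond the size, and `m =
s` otherwise. At `i = m + 1` no killed nonzero row can survive, so the minimum is attained by then.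
-/
theorem isLeast_segment_leftRegDegree [CharZero K] {a : I1 K} {m : ℤ} (h1 : -1 ≤ m)
    (hm : ∀ q : K[X], q ≠ 0 → rowMap K q * a = 0 → (q.natDegree : ℤ) ≤ m) :
    IsLeast {i : ℕ | (i : ℤ) ≤ m + 1 ∧ kerRight a ⊓ derSegment K i (m + 1) = ⊥}
      (leftRegDegree a) := by
  have hmem : der K ^ (m + 1).toNat * a ∈ leftRegularElements (I1 K) :=
    der_pow_mul_mem_of_lt hm (by omega)
  obtain ⟨hd, hl⟩ := isLeast_leftRegDegree ⟨_, hmem⟩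
  have hle : leftRegDegree a ≤ (m + 1).toNat := hl hmem
  refine ⟨⟨by omega, ?_⟩, fun i hi => hl ?_⟩
  · exact (der_pow_mul_mem_leftRegularElements_iff_inf (by omega) hm).1 hd
  · exact (der_pow_mul_mem_leftRegularElements_iff_inf (by omega) hm).2 hi.2

/-! ### Integer roots of `a₀` and the degree on `Γ` -/

theorem bigRoots_finite [CharZero K] {a₀ : K[X]} (h : a₀ ≠ 0) (s : ℤ) : (bigRoots a₀ s).Finite := by
  have hinj : Function.Injective fun i : ℕ => (i : K) + 1 := fun i j hij => by simpa using hij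
  classical
  refine ((a₀.roots.toFinset.finite_toSet).preimage hinj.injOn).subset fun i hi => ?_
  simpa [h] using hi.1

theorem exists_isGreatest_bigRoots [CharZero K] {a₀ : K[X]} (h : a₀ ≠ 0) {s : ℤ}
    (hne : bigRoots a₀ s ≠ ∅) : ∃ r, IsGreatest (bigRoots a₀ s) r := by
  obtain ⟨r, hr, hmax⟩ := Set.exists_max_image _ id (bigRoots_finite h s)
    (Set.nonempty_iff_ne_empty.2 hne)
  exact ⟨r, hr, hmax⟩

theorem natDegree_le_of_isGreatest [CharZero K] {p : ℕ →₀ K[X]} {f : I1 K} (hf : f ∈ F K) {r : ℕ}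
    (hr : IsGreatest (bigRoots (p 0) (size f)) r) (q : K[X]) (hq : q ≠ 0)
    (h : rowMap K q * canonicalSum p f = 0) : (q.natDegree : ℤ) ≤ r := by
  rcases natDegree_of_rowMap_mul_eq_zero hf hq h with h | h
  · have := hr.1.2
    omega
  · exact_mod_cast hr.2 h

theorem natDegree_le_size [CharZero K] {p : ℕ →₀ K[X]} {f : I1 K} (hf : f ∈ F K)
    (hr : bigRoots (p 0) (size f) = ∅) (q : K[X]) (hq : q ≠ 0)
    (h : rowMap K q * canonicalSum p f = 0) : (q.natDegree : ℤ) ≤ size f :=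
  (natDegree_of_rowMap_mul_eq_zero hf hq h).resolve_right (by simp [hr])

theorem bigRoots_eq_empty_of_mem_leftRegularElements [CharZero K] {p : ℕ →₀ K[X]} {f : I1 K}
    (hf : f ∈ F K) (h : canonicalSum p f ∈ leftRegularElements (I1 K)) :
    bigRoots (p 0) (size f) = ∅ := by
  rw [Set.eq_empty_iff_forall_notMem]
  intro d hd
  obtain ⟨q, hq, hqa⟩ := exists_rowMap_mul_eq_zero hf hd
  exact hq (mem_leftRegularElements_iff.1 h q hqa)

theorem isLeast_leftRegDegree_of_mem_Gam [CharZero K] {a : I1 K} (ha : a ∈ Gam K) :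
    IsLeast {i : ℕ | der K ^ i * a ∈ leftRegularElements (I1 K)} (leftRegDegree a) := by
  obtain ⟨p, f, hp, hf, rfl⟩ := ha
  apply isLeast_leftRegDegree
  by_cases h : bigRoots (p 0) (size f) = ∅
  · exact ⟨(size f + 1).toNat, der_pow_mul_mem_of_lt (natDegree_le_size hf h) (by omega)⟩
  · obtain ⟨r, hr⟩ := exists_isGreatest_bigRoots hp h
    exact ⟨r + 1, der_pow_mul_mem_of_lt (natDegree_le_of_isGreatest hf hr) (by omega)⟩

/-! ### Description of the left and right regular elements -/

/-- The least exponent that makes `∫^k b` a canonical sum works: `a₀ = 0` would contradict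
minimality when `k > 0` and left regularity when `k = 0`. -/
theorem exists_int_pow_mul_mem_Gam [CharZero K] {b : I1 K}
    (hb : b ∈ leftRegularElements (I1 K)) : ∃ k, int K ^ k * b ∈ Gam K := by
  classical
  have hex := exists_int_pow_mul_mem_canonicalSums b
  obtain ⟨p, f, hf, h⟩ := mem_canonicalSums.1 (Nat.find_spec hex)
  refine ⟨Nat.find hex, p, f, fun hp => ?_, hf, h⟩
  rcases hk : Nat.find hex with _ | k
  · rw [hk, pow_zero, one_mul] at h
    rw [h] at hb
    have he := bigRoots_eq_empty_of_mem_leftRegularElements hf hb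
    -- Every natural number is a root of the zero polynomial; this one exceeds the size.
    have hmem : (size f + 1).toNat ∈ bigRoots (p 0) (size f) := ⟨by rw [hp, eval_zero], by omega⟩
    simp [he] at hmem
  · refine Nat.find_min hex (m := k) (by omega) ?_
    have := der_mul_canonicalSum_mem hp hf
    rwa [← h, hk, pow_succ', ← mul_assoc, ← mul_assoc, der_mul_int, one_mul] at this

theorem leftRegularElements_eq [CharZero K] :
    leftRegularElements (I1 K) =
      {b | ∃ a ∈ Gam K, ∃ i : ℕ, b = der K ^ (leftRegDegree a + i) * a} := by
  ext b
  constructor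
  · intro hb
    obtain ⟨k, hk⟩ := exists_int_pow_mul_mem_Gam hb
    have hbk : der K ^ k * (int K ^ k * b) = b := by
      rw [← mul_assoc, der_pow_mul_int_pow, one_mul]
    -- `∂^k` carries `∫^k b` back to the left regular `b`, so `k` is admissible in the definition of
    -- the degree.
    have hle : leftRegDegree (int K ^ k * b) ≤ k := by
      refine (isLeast_leftRegDegree_of_mem_Gam hk).2 ?_
      rw [Set.mem_ofPred_eq, hbk]
      exact hb
    exact ⟨_, hk, k - leftRegDegree (int K ^ k * b), by rw [Nat.add_sub_cancel' hle, hbk]⟩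
  · rintro ⟨a, ha, i, rfl⟩
    rw [add_comm, pow_add, mul_assoc]
    exact der_pow_mul_mem_leftRegularElements (isLeast_leftRegDegree_of_mem_Gam ha).1 i

theorem rightRegularElements_eq [CharZero K] :
    rightRegularElements (I1 K) = invol '' leftRegularElements (I1 K) := by
  have hmul : ∀ a b : I1 K, invol (a * b) = invol b * invol a := adj_mul
  have hzero : invol (0 : I1 K) = 0 := by simp [invol]
  have hinj : ∀ a : I1 K, invol a = 0 → a = 0 := fun a h => by
    rw [← invol_invol a, h, hzero]
  ext c
  constructor
  · intro hc
    refine ⟨invol c, fun r hr => hinj r (hc _ (hinj _ ?_)), invol_invol c⟩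
    rw [hmul, invol_invol, hr]
  · rintro ⟨c, hc, rfl⟩ r hr
    refine hinj r (hc _ (hinj _ ?_))
    rw [hmul, invol_invol, hr]

theorem canonicalSum_mem_leftRegularElements_iff [CharZero K] {p : ℕ →₀ K[X]} {f : I1 K}
    (hf : f ∈ F K) : canonicalSum p f ∈ leftRegularElements (I1 K) ↔
      bigRoots (p 0) (size f) = ∅ ∧
        kerRight (canonicalSum p f) ⊓ derSegment K 0 (size f) = ⊥ := by
  have key (h : bigRoots (p 0) (size f) = ∅) := der_pow_mul_mem_leftRegularElements_iff_inf
    (i := 0) le_rfl (natDegree_le_size hf h)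
  simp only [pow_zero, one_mul] at key
  exact ⟨fun h => ⟨bigRoots_eq_empty_of_mem_leftRegularElements hf h,
    (key (bigRoots_eq_empty_of_mem_leftRegularElements hf h)).1 h⟩, fun h => (key h.1).2 h.2⟩

end PolyIntDiff

end

theorem mainTheorem11 (K : Type*) [Field K] [CharZero K] :
    (∀ a ∈ Gam K,
      IsLeast {i : ℕ | der K ^ i * a ∈ leftRegularElements (I1 K)} (leftRegDegree a)) ∧
    leftRegularElements (I1 K) =
      {b | ∃ a ∈ Gam K, ∃ i : ℕ, b = der K ^ (leftRegDegree a + i) * a} ∧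
    (∀ (p : ℕ →₀ K[X]) (f a : I1 K), p 0 ≠ 0 → f ∈ F K → a = canonicalSum p f →
      (a ∈ leftRegularElements (I1 K) ↔
        bigRoots (p 0) (size f) = ∅ ∧ kerRight a ⊓ derSegment K 0 (size f) = ⊥) ∧
      (bigRoots (p 0) (size f) = ∅ → kerRight a ⊓ derSegment K 0 (size f) = ⊥ →
        leftRegDegree a = 0) ∧
      (bigRoots (p 0) (size f) ≠ ∅ →
        ∃ r : ℕ, IsGreatest (bigRoots (p 0) (size f)) r ∧
          IsLeast {i : ℕ | i ≤ r + 1 ∧ kerRight a ⊓ derSegment K i (r + 1) = ⊥}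
            (leftRegDegree a)) ∧
      (bigRoots (p 0) (size f) = ∅ → kerRight a ⊓ derSegment K 0 (size f) ≠ ⊥ →
        IsLeast {i : ℕ | (i : ℤ) ≤ size f + 1 ∧
          kerRight a ⊓ derSegment K i (size f + 1) = ⊥} (leftRegDegree a))) ∧
    rightRegularElements (I1 K) = invol '' leftRegularElements (I1 K) := by
  refine ⟨fun a ha => isLeast_leftRegDegree_of_mem_Gam ha, leftRegularElements_eq, ?_,
    rightRegularElements_eq⟩
  rintro p f _ hp hf rfl
  refine ⟨canonicalSum_mem_leftRegularElements_iff hf, fun h1 h2 => ?_, fun h => ?_,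
    fun h _ => isLeast_segment_leftRegDegree (neg_one_le_size f) (natDegree_le_size hf h)⟩
  · have := (canonicalSum_mem_leftRegularElements_iff hf).2 ⟨h1, h2⟩
    exact Nat.sInf_eq_zero.2 (Or.inl (by simpa using this))
  · obtain ⟨r, hr⟩ := exists_isGreatest_bigRoots hp h
    refine ⟨r, hr, ?_⟩
    have := isLeast_segment_leftRegDegree (m := r) (by omega) (natDegree_le_of_isGreatest hf hr)
    simpa only [← Nat.cast_succ, Nat.cast_le] using this
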